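/- Let $I=[0,1)$ and, for $k\in\{2,3,\dots\}\cup\{\infty\}$, let $\mathrm{Diff}_+^k(I)$ be the group of orientation-preserving $C^k$-diffeomorphisms of $I$. A *flow* in $\mathrm{Diff}_+^k(I)$ is a family $\{\chi^t\}_{t\in\mathbb R}\subset\mathrm{Diff}_+^k(I)$ with $\chi^{t+u}=\chi^t\circ\chi^u$ for all $t,u\in\mathbb R$ which is continuous in $t$, meaning that the map $(t,x)\mapsto\chi^t(x)$, $\mathbb R\times I\to I$, is continuous. Let $p,r\ge 2$ (possibly $\infty$) and let $\Phi:\mathrm{Diff}_+^r(I)\to\mathrm{Diff}_+^p(I)$ be an injective group homomorphism (not assumed continuous). Let $\{\phi^t\}$ be a flow in $\mathrm{Diff}_+^r(I)$ that is fixed point free on $(0,1)$, i.e. no $x\in(0,1)$ satisfies $\phi^t(x)=x$ for all $t$, and suppose that there is some $s\in\mathbb R$ such that $\Phi(\phi^s)$ has no fixed point in $(0,1)$. Then $\Phi(\phi^t)$ is continuous in $t$, i.e. $(t,x)\mapsto\Phi(\phi^t)(x)$ is continuous on $\mathbb R\times I$. Moreover, there are a flow $\{\psi^t\}$ in $\mathrm{Diff}_+^p(I)$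 and $\lambda\in\mathbb R$ such that $\Phi(\phi^t)=\psi^{\lambda t}$ for all $t\in\mathbb R$. -/

import Mathlib

open Set

/-- The half-open interval `I = [0, 1)`. -/
abbrev HalfOpen : Type := Set.Ico (0 : ℝ) 1

/-- A self-map of `[0, 1)` is of class `C^r` (with one-sided derivatives at `0`): read as a
real-valued function of a real variable it is `C^r` on `[0, 1)`.  Values of `F` off `[0, 1)` are
irrelevant. -/
def IsClassC (r : ℕ∞) (f : HalfOpen → HalfOpen) : Prop :=
  ∃ F : ℝ → ℝ, ContDiffOn ℝ (r : WithTop ℕ∞) F (Set.Ico (0 : ℝ) 1) ∧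
    ∀ x : HalfOpen, F x = (f x : ℝ)

theorem IsClassC.id (r : ℕ∞) : IsClassC r (fun x => x) :=
  ⟨fun x => x, contDiffOn_id, fun _ => rfl⟩

theorem IsClassC.comp {r : ℕ∞} {f g : HalfOpen → HalfOpen}
    (hf : IsClassC r f) (hg : IsClassC r g) : IsClassC r (fun x => f (g x)) := by
  obtain ⟨F, hF, hFf⟩ := hf
  obtain ⟨G, hG, hGg⟩ := hg
  refine ⟨F ∘ G, hF.comp hG ?_, ?_⟩
  · intro x hx
    rw [hGg ⟨x, hx⟩]
    exact (g ⟨x, hx⟩).2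
  · intro x
    rw [Function.comp_apply, hGg, hFf]

/-- The group `Diff₊^r(I)`, under composition, of orientation-preserving `C^r`-diffeomorphisms of
`I = [0, 1)`: increasing bijections of `I` that are `C^r` together with their inverse. -/
def DiffPlus (r : ℕ∞) : Subgroup (Equiv.Perm HalfOpen) where
  carrier := {f | StrictMono f ∧ IsClassC r f ∧ IsClassC r f.symm}
  one_mem' := ⟨strictMono_id, IsClassC.id r, IsClassC.id r⟩
  mul_mem' := fun ha hb => ⟨ha.1.comp hb.1, ha.2.1.comp hb.2.1, hb.2.2.comp ha.2.2⟩
  inv_mem' := fun {f} hf => by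
    refine ⟨fun x y hxy => ?_, hf.2.2, hf.2.1⟩
    rw [← hf.1.lt_iff_lt]
    simpa using hxy

/-- A family `(χ^t)` of elements of `Diff₊^r(I)` is continuous in `t`: it is a continuous
family of diffeomorphisms, i.e. `(t, x) ↦ χ^t(x)` is a continuous map `ℝ × I → I`. -/
def IsContinuousFamily {r : ℕ∞} (χ : ℝ → DiffPlus r) : Prop :=
  Continuous (fun q : ℝ × HalfOpen => (χ q.1 : Equiv.Perm HalfOpen) q.2)

/-- A flow in `Diff₊^r(I)`: a continuous one-parameter subgroup `t ↦ φ^t`. -/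
structure IsFlow {r : ℕ∞} (φ : ℝ → DiffPlus r) : Prop where
  map_add : ∀ s t : ℝ, φ (s + t) = φ s * φ t
  continuous_family : IsContinuousFamily φ

/-! The homeomorphisms `Φ (φ t)` form an abelian group, one of whose elements has no fixed point in
`(0, 1)`. By Kopell's lemma (`kopell`), which is where `C²` regularity enters, every nontrivial
element then acts on `(0, 1)` without fixed points. Hölder's theorem (`exists_translation_number`)
gives an additive injection `α : ℝ → ℝ` that records the order of the orbits. Since `ℝ` is
uncountable there are no wandering intervals, so `Φ (φ t) x` is jointly continuous in `α t` and `x`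
(`tendsto_apply`). It remains to show that `α` is continuous.

For this, the topology of the time line is encoded in commutation relations, which `Φ` preserves
and, being injective, reflects. A bump diffeomorphism `g` supported on a fundamental interval of the
flow commutes with its conjugate by `φ t` when `|t| > 1`, but not when `|t| = 1/2` with the right
sign (`IsFlow.exists_commute_conj`). If `α` were discontinuous, its graph would be dense, so `α t₀`
would be a limit of values `α t` with `|t|` large. The commutation of `Φ g` with its conjugates
would pass to the limit and hold at `t₀`, a contradiction. -/

open Filter Topology

/-! ### Elementary properties of increasing permutations of `[0, 1)` -/

/-- The endpoint `0` of `[0, 1)`. -/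
def HalfOpen.zero : HalfOpen := ⟨0, le_rfl, one_pos⟩

theorem DiffPlus.mono {r p : ℕ∞} (h : p ≤ r) : DiffPlus r ≤ DiffPlus p := by
  have key : ∀ f : HalfOpen → HalfOpen, IsClassC r f → IsClassC p f := by
    rintro f ⟨F, hF, hFf⟩
    exact ⟨F, hF.of_le (by exact_mod_cast h), hFf⟩
  exact fun f hf => ⟨hf.1, key _ hf.2.1, key _ hf.2.2⟩

theorem StrictMono.continuous_perm {f : Equiv.Perm HalfOpen} (hf : StrictMono f) :
    Continuous f :=
  (hf.orderIsoOfSurjective f f.surjective).continuous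

theorem StrictMono.perm_zero {f : Equiv.Perm HalfOpen} (hf : StrictMono f) :
    f HalfOpen.zero = HalfOpen.zero := by
  apply le_antisymm
  · obtain ⟨x, hx⟩ := f.surjective HalfOpen.zero
    conv_rhs => rw [← hx]
    exact hf.monotone (show (0 : ℝ) ≤ x from x.2.1)
  · exact (f HalfOpen.zero).2.1

theorem StrictMono.perm_pos {f : Equiv.Perm HalfOpen} (hf : StrictMono f) {x : HalfOpen}
    (hx : 0 < (x : ℝ)) : 0 < (f x : ℝ) := by
  have : f HalfOpen.zero < f x := hf (show (0 : ℝ) < x from hx)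
  rw [hf.perm_zero] at this
  exact this

theorem isPreconnected_halfOpen_pos : IsPreconnected {x : HalfOpen | 0 < (x : ℝ)} := by
  rw [← IsInducing.subtypeVal.isPreconnected_image]
  convert isPreconnected_Ioo (a := (0 : ℝ)) (b := 1)
  ext y
  constructor
  · rintro ⟨x, hx, rfl⟩
    exact ⟨hx, x.2.2⟩
  · rintro ⟨h0, h1⟩
    exact ⟨⟨y, h0.le, h1⟩, h0, rfl⟩

theorem lt_self_or_self_lt_of_forall_ne {f : Equiv.Perm HalfOpen} (hf : StrictMono f)
    (hne : ∀ x : HalfOpen, 0 < (x : ℝ) → f x ≠ x) :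
    (∀ x : HalfOpen, 0 < (x : ℝ) → f x < x) ∨ (∀ x : HalfOpen, 0 < (x : ℝ) → x < f x) := by
  by_contra! h
  obtain ⟨⟨x, hx, hx'⟩, y, hy, hy'⟩ := h
  obtain ⟨z, hz, hz'⟩ := isPreconnected_halfOpen_pos.intermediate_value₂ hy hx
    hf.continuous_perm.continuousOn continuousOn_id hy' hx'
  exact hne z hz hz'

/-- A decreasing orbit bounded away from `0` would converge to an interior fixed point. -/
theorem exists_iterate_lt {f : Equiv.Perm HalfOpen} (hf : StrictMono f)
    (hlt : ∀ x : HalfOpen, 0 < (x : ℝ) → f x < x) (x : HalfOpen) {δ : ℝ} (hδ : 0 < δ) :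
    ∃ n : ℕ, ((f ^ n) x : ℝ) < δ := by
  by_contra! h
  have hle : ∀ y : HalfOpen, f y ≤ y := fun y => by
    rcases y.2.1.eq_or_lt with h0 | h0
    · have : y = HalfOpen.zero := Subtype.ext h0.symm
      rw [this, hf.perm_zero]
    · exact (hlt y h0).le
  have hanti : Antitone fun n : ℕ => ((f ^ n) x : ℝ) := antitone_nat_of_succ_le fun n => by
    rw [pow_succ', Equiv.Perm.mul_apply]
    exact hle _
  have hbdd : BddBelow (range fun n : ℕ => ((f ^ n) x : ℝ)) := ⟨δ, by rintro _ ⟨n, rfl⟩; exact h n⟩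
  have hlim := tendsto_atTop_ciInf hanti hbdd
  set m := ⨅ n : ℕ, ((f ^ n) x : ℝ)
  have hδm : δ ≤ m := le_ciInf h
  have hm1 : m < 1 := (ciInf_le hbdd 0).trans_lt ((f ^ 0) x).2.2
  have hm0 : 0 < m := hδ.trans_le hδm
  let M : HalfOpen := ⟨m, hm0.le, hm1⟩
  have h1 : Tendsto (fun n : ℕ => (f ^ n) x) atTop (𝓝 M) := tendsto_subtype_rng.2 hlim
  have h2 : Tendsto (fun n : ℕ => (f ^ (n + 1)) x) atTop (𝓝 M) := (tendsto_add_atTop_iff_nat 1).2 h1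
  have h3 : Tendsto (fun n : ℕ => (f ^ (n + 1)) x) atTop (𝓝 (f M)) := by
    simpa only [pow_succ', Equiv.Perm.mul_apply, Function.comp_def] using
      (hf.continuous_perm.tendsto M).comp h1
  exact (hlt M hm0).ne (tendsto_nhds_unique h3 h2)

/-! ### Kopell's lemma -/

theorem IsClassC.exists_mean_value {r : ℕ∞} (hr : 1 ≤ r) {f : HalfOpen → HalfOpen}
    (hf : IsClassC r f) :
    ∃ F' : ℝ → ℝ, (∀ m : ℕ∞, m + 1 ≤ r → ContDiffOn ℝ m F' (Ico 0 1)) ∧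
      ∀ u v : HalfOpen, u < v → ∃ ξ ∈ Ioo (u : ℝ) v, (f v : ℝ) - f u = F' ξ * (v - u) := by
  obtain ⟨F, hF, hFf⟩ := hf
  refine ⟨derivWithin F (Ico 0 1), fun m hm => hF.derivWithin (uniqueDiffOn_Ico 0 1)
    (by exact_mod_cast hm), fun u v huv => ?_⟩
  have hsub : Icc (u : ℝ) v ⊆ Ico 0 1 := fun x hx => ⟨u.2.1.trans hx.1, hx.2.trans_lt v.2.2⟩
  have hr0 : ((r : ℕ∞) : WithTop ℕ∞) ≠ 0 := by
    have : r ≠ 0 := by rintro rfl; simp at hr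
    exact_mod_cast this
  have hd := hF.differentiableOn hr0
  have huv' : (u : ℝ) < v := huv
  obtain ⟨ξ, hξ, h⟩ := exists_hasDerivAt_eq_slope F (derivWithin F (Ico 0 1)) huv'
    (hF.continuousOn.mono hsub) (fun x hx => by
      have hx' : x ∈ Ioo (0 : ℝ) 1 := ⟨u.2.1.trans_lt hx.1, hx.2.trans v.2.2⟩
      exact (hd x (Ioo_subset_Ico_self hx')).hasDerivWithinAt.hasDerivAt
        (Ico_mem_nhds hx'.1 hx'.2))
  refine ⟨ξ, hξ, ?_⟩
  rw [h, hFf, hFf, div_mul_cancel₀ _ (sub_pos.2 huv').ne']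

/-- Applied to the inverse of a diffeomorphism, this bounds its derivative away from `0`. -/
theorem IsClassC.exists_slope_le {r : ℕ∞} (hr : 1 ≤ r) {f : HalfOpen → HalfOpen}
    (hf : IsClassC r f) (x : HalfOpen) :
    ∃ M : ℝ, 0 ≤ M ∧ ∀ u v : HalfOpen, u ≤ v → v ≤ x → (f v : ℝ) - f u ≤ M * (v - u) := by
  obtain ⟨F, hF, hFf⟩ := hf
  have hr0 : ((r : ℕ∞) : WithTop ℕ∞) ≠ 0 := by
    have : r ≠ 0 := by rintro rfl; simp at hr
    exact_mod_cast this
  have hsub : Icc (0 : ℝ) x ⊆ Ico 0 1 := fun y hy => ⟨hy.1, hy.2.trans_lt x.2.2⟩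
  obtain ⟨K, hK⟩ := (hF.mono hsub).exists_lipschitzOnWith hr0 (convex_Icc _ _) isCompact_Icc
  refine ⟨K, K.2, fun u v huv hv => ?_⟩
  have huv' : (u : ℝ) ≤ v := huv
  have := hK.dist_le_mul v ⟨v.2.1, hv⟩ u ⟨u.2.1, huv.trans hv⟩
  rw [hFf, hFf, Real.dist_eq, Real.dist_eq, abs_of_nonneg (sub_nonneg.2 huv')] at this
  exact (le_abs_self _).trans this

/-- One step of the bounded distortion estimate. -/
theorem exists_distortion_step {f : Equiv.Perm HalfOpen} (hf : f ∈ DiffPlus 2) (x : HalfOpen) :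
    ∃ K : ℝ, 0 ≤ K ∧ ∀ a b u v w z : HalfOpen, b ≤ x → a ≤ u → u < v → v ≤ b →
      a ≤ w → w < z → z ≤ b →
      ((f v : ℝ) - f u) * (z - w) ≤ Real.exp (K * (b - a)) * (((f z : ℝ) - f w) * (v - u)) := by
  obtain ⟨F', hF', hmv⟩ := hf.2.1.exists_mean_value (by norm_num)
  obtain ⟨M, hM0, hM⟩ := hf.2.2.exists_slope_le (by norm_num) (f x)
  have hsub : Icc (0 : ℝ) x ⊆ Ico 0 1 := fun y hy => ⟨hy.1, hy.2.trans_lt x.2.2⟩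
  obtain ⟨L, hL⟩ := ((hF' 1 (by norm_num)).mono hsub).exists_lipschitzOnWith (by simp)
    (convex_Icc _ _) isCompact_Icc
  refine ⟨M * L, mul_nonneg hM0 L.2, fun a b u v w z hbx hau huv hvb haw hwz hzb => ?_⟩
  obtain ⟨ξ, hξ, h1⟩ := hmv u v huv
  obtain ⟨η, hη, h2⟩ := hmv w z hwz
  have huv' : (0 : ℝ) < v - u := sub_pos.2 huv
  have hwz' : (0 : ℝ) < z - w := sub_pos.2 hwz
  have hau' : (a : ℝ) ≤ u := hau
  have haw' : (a : ℝ) ≤ w := haw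
  have hvb' : (v : ℝ) ≤ b := hvb
  have hzb' : (z : ℝ) ≤ b := hzb
  have hbx' : (b : ℝ) ≤ x := hbx
  have ha0 : (0 : ℝ) ≤ a := a.2.1
  have h3 : (z : ℝ) - w ≤ M * (f z - f w) := by
    simpa using hM (f w) (f z) (hf.1.monotone hwz.le) (hf.1.monotone (hzb.trans hbx))
  have h4 : 1 ≤ M * F' η := by
    rw [h2] at h3
    by_contra! h
    nlinarith
  have h5 : F' ξ ≤ F' η + L * (b - a) := by
    have := hL.dist_le_mul ξ ⟨by linarith [hξ.1], by linarith [hξ.2]⟩ η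
      ⟨by linarith [hη.1], by linarith [hη.2]⟩
    rw [Real.dist_eq, Real.dist_eq] at this
    have h6 : |ξ - η| ≤ b - a := abs_le.2 ⟨by linarith [hξ.1, hη.2], by linarith [hξ.2, hη.1]⟩
    have := (le_abs_self _).trans (this.trans (mul_le_mul_of_nonneg_left h6 L.2))
    linarith
  have h7 : 0 ≤ F' η := by
    by_contra! h
    nlinarith
  have hL0 : (0 : ℝ) ≤ L * (b - a) := mul_nonneg L.2 (by linarith)
  -- Since `1 ≤ M * F' η`, the additive error `L * (b - a)` becomes a multiplicative one. The
  -- exponential form lets the errors of successive iterates add up in the exponent.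
  have h8 : F' ξ ≤ Real.exp (M * L * (b - a)) * F' η := by
    have h9 := Real.add_one_le_exp (M * L * (b - a))
    calc F' ξ ≤ F' η + L * (b - a) := h5
      _ ≤ F' η + (M * F' η) * (L * (b - a)) := by nlinarith
      _ = (M * L * (b - a) + 1) * F' η := by ring
      _ ≤ _ := mul_le_mul_of_nonneg_right h9 h7
  rw [h1, h2]
  calc F' ξ * (v - u) * (z - w) = F' ξ * ((v - u) * (z - w)) := by ring
    _ ≤ Real.exp (M * L * (b - a)) * F' η * ((v - u) * (z - w)) :=
      mul_le_mul_of_nonneg_right h8 (mul_pos huv' hwz').le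
    _ = _ := by ring

/-- Bounded distortion of the iterates of a `C²` contraction on a fundamental domain. -/
theorem exists_distortion {f : Equiv.Perm HalfOpen} (hf : f ∈ DiffPlus 2)
    (hlt : ∀ x : HalfOpen, 0 < (x : ℝ) → f x < x) {x : HalfOpen} (hx : 0 < (x : ℝ)) :
    ∃ C : ℝ, 0 < C ∧ ∀ (n : ℕ) (u v w z : HalfOpen), f x ≤ u → u < v → v ≤ x →
      f x ≤ w → w < z → z ≤ x →
      (((f ^ n) v : ℝ) - (f ^ n) u) * (z - w) ≤ C * ((((f ^ n) z : ℝ) - (f ^ n) w) * (v - u)) := by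
  obtain ⟨K, hK0, hK⟩ := exists_distortion_step hf x
  have hmono : ∀ n : ℕ, StrictMono (f ^ n) := fun n => (pow_mem hf n).1
  refine ⟨Real.exp (K * x), Real.exp_pos _, fun n u v w z hu huv hv hw hwz hz => ?_⟩
  have huv' : (0 : ℝ) < v - u := sub_pos.2 huv
  have hwz' : (0 : ℝ) < z - w := sub_pos.2 hwz
  -- The steps take place on the consecutive intervals `[f^(k+1) x, f^k x]`, so the exponents
  -- telescope to `x - f^n x ≤ x`, which makes the constant independent of `n`.
  have key : (((f ^ n) v : ℝ) - (f ^ n) u) * (z - w) ≤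
      Real.exp (K * (x - (f ^ n) x)) * ((((f ^ n) z : ℝ) - (f ^ n) w) * (v - u)) := by
    induction n with
    | zero => simp [mul_comm]
    | succ n ih =>
      have hle : (f ^ n) x ≤ x := by
        clear ih
        induction n with
        | zero => exact le_rfl
        | succ n ih =>
          rw [pow_succ', Equiv.Perm.mul_apply]
          exact (hlt _ ((hmono n).perm_pos hx)).le.trans ih
      have hfx : ∀ y, f x ≤ y → (f ^ (n + 1)) x ≤ (f ^ n) y := fun y hy => by
        rw [pow_succ, Equiv.Perm.mul_apply]
        exact (hmono n).monotone hy
      have step := hK ((f ^ (n + 1)) x) ((f ^ n) x) ((f ^ n) u) ((f ^ n) v) ((f ^ n) w) ((f ^ n) z)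
        hle (hfx u hu) (hmono n huv) ((hmono n).monotone hv) (hfx w hw) (hmono n hwz)
        ((hmono n).monotone hz)
      simp only [← Equiv.Perm.mul_apply, ← pow_succ'] at step
      have hA : (0 : ℝ) < (f ^ n) z - (f ^ n) w := sub_pos.2 (hmono n hwz)
      have hB : (0 : ℝ) < (f ^ n) v - (f ^ n) u := sub_pos.2 (hmono n huv)
      have hD : (0 : ℝ) < (f ^ (n + 1)) z - (f ^ (n + 1)) w := sub_pos.2 (hmono (n + 1) hwz)
      have hexp : Real.exp (K * (x - (f ^ (n + 1)) x)) =
          Real.exp (K * ((f ^ n) x - (f ^ (n + 1)) x)) * Real.exp (K * (x - (f ^ n) x)) := by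
        rw [← Real.exp_add]
        ring_nf
      rw [hexp]
      have hE₁0 := (Real.exp_pos (K * ((f ^ n) x - (f ^ (n + 1)) x))).le
      generalize Real.exp (K * ((f ^ n) x - (f ^ (n + 1)) x)) = E₁ at *
      generalize hE₂ : Real.exp (K * (x - (f ^ n) x)) = E₂ at *
      generalize ((f ^ n) z : ℝ) - (f ^ n) w = A at *
      generalize ((f ^ n) v : ℝ) - (f ^ n) u = B at *
      generalize ((f ^ (n + 1)) z : ℝ) - (f ^ (n + 1)) w = D at *
      generalize ((f ^ (n + 1)) v : ℝ) - (f ^ (n + 1)) u = N at *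
      generalize (z : ℝ) - w = p at *
      generalize (v : ℝ) - u = q at *
      have hE₁ : 0 ≤ E₁ * D := mul_nonneg hE₁0 hD.le
      refine le_of_mul_le_mul_right ?_ (mul_pos hA hB)
      calc N * p * (A * B) = (N * A) * (p * B) := by ring
        _ ≤ (E₁ * (D * B)) * (p * B) := mul_le_mul_of_nonneg_right step (mul_pos hwz' hB).le
        _ = (E₁ * D) * B * (B * p) := by ring
        _ ≤ (E₁ * D) * B * (E₂ * (A * q)) :=
          mul_le_mul_of_nonneg_left ih (mul_nonneg hE₁ hB.le)
        _ = _ := by ring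
  refine key.trans (mul_le_mul_of_nonneg_right (Real.exp_le_exp.2 ?_) ?_)
  · exact mul_le_mul_of_nonneg_left (by linarith [((f ^ n) x).2.1]) hK0
  · exact mul_nonneg (sub_nonneg.2 ((hmono n).monotone hwz.le)) huv'.le

/-- A `C¹` map with fixed points accumulating at `0` has derivative `1` there. -/
theorem exists_half_le_slope {g : HalfOpen → HalfOpen} (hg : IsClassC 1 g)
    (hg0 : g HalfOpen.zero = HalfOpen.zero)
    (hfix : ∀ δ : ℝ, 0 < δ → ∃ c : HalfOpen, 0 < (c : ℝ) ∧ (c : ℝ) < δ ∧ g c = c) :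
    ∃ δ : ℝ, 0 < δ ∧ ∀ u v : HalfOpen, u < v → (v : ℝ) < δ →
      ((v : ℝ) - u) / 2 ≤ (g v : ℝ) - g u := by
  obtain ⟨F', hF', hmv⟩ := hg.exists_mean_value le_rfl
  have hc : ContinuousOn F' (Ico 0 1) := (hF' 0 (by norm_num)).continuousOn
  -- The derivative equals `1` at some point between `0` and a fixed point `c`. Two deviations of `1
  -- / 4` from `F' 0` keep it above `1 / 2`.
  obtain ⟨δ, hδ, hδ'⟩ := Metric.continuousWithinAt_iff.1 (hc 0 ⟨le_rfl, one_pos⟩) (1 / 4) (by norm_num)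
  have hF'0 : ∀ ξ : ℝ, 0 ≤ ξ → ξ < 1 → ξ < δ → |F' ξ - F' 0| < 1 / 4 := fun ξ h0 h1 h2 =>
    hδ' ⟨h0, h1⟩ (by rwa [Real.dist_eq, sub_zero, abs_of_nonneg h0])
  obtain ⟨c, hc0, hcδ, hgc⟩ := hfix δ hδ
  obtain ⟨ξ, hξ, h⟩ := hmv HalfOpen.zero c hc0
  rw [hgc, hg0] at h
  have hz : ((HalfOpen.zero : HalfOpen) : ℝ) = 0 := rfl
  rw [hz] at h hξ
  have h1 : F' ξ = 1 := by
    have : (F' ξ - 1) * c = 0 := by linarith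
    rcases mul_eq_zero.1 this with h | h <;> linarith
  have h2 := abs_lt.1 (hF'0 ξ hξ.1.le (hξ.2.trans c.2.2) (hξ.2.trans hcδ))
  refine ⟨δ, hδ, fun u v huv hv => ?_⟩
  obtain ⟨η, hη, h⟩ := hmv u v huv
  have h3 := abs_lt.1 (hF'0 η (u.2.1.trans hη.1.le) (hη.2.trans v.2.2) (hη.2.trans hv))
  have huv' : (0 : ℝ) < v - u := sub_pos.2 huv
  rw [h]
  nlinarith [h3.1, h3.2, h2.1, h2.2]

theorem Commute.perm_apply {f g : Equiv.Perm HalfOpen} (h : Commute f g) (x : HalfOpen) :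
    f (g x) = g (f x) := by
  rw [← Equiv.Perm.mul_apply, h.eq, Equiv.Perm.mul_apply]

/-- If `y < g y`, the intervals `[g^k y, g^(k+1) y]` have disjoint interiors and lie in `[f x, x]`.
Pushed near `0` by `f^n`, the `k`-th one is the image under `g^k` of the pushed interval `[y, g y]`.
There `g^k` has slope at least `1 / 2`, because it fixes the points `f^n x`. Bounded distortion
carries this back, so all these intervals have length at least a fixed positive constant, which is
impossible. -/
theorem kopell_fundamental_domain {f g : Equiv.Perm HalfOpen} (hf : f ∈ DiffPlus 2)
    (hg : g ∈ DiffPlus 1) (hfg : Commute f g) (hlt : ∀ x : HalfOpen, 0 < (x : ℝ) → f x < x)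
    {x : HalfOpen} (hx : 0 < (x : ℝ)) (hgx : g x = x) {y : HalfOpen} (hy : f x ≤ y)
    (hyx : y ≤ x) : g y ≤ y := by
  by_contra! hgy
  obtain ⟨C, hC, hdist⟩ := exists_distortion hf hlt hx
  have hfm : ∀ n : ℕ, StrictMono (f ^ n) := fun n => (pow_mem hf n).1
  have hgm : ∀ n : ℕ, StrictMono (g ^ n) := fun n => (pow_mem hg n).1
  have hfixpow : ∀ (z : HalfOpen) (k : ℕ), g z = z → (g ^ k) z = z := fun z k hz => by
    induction k with
    | zero => rfl
    | succ k ih => rw [pow_succ, Equiv.Perm.mul_apply, hz, ih]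
  have hfixf : ∀ n : ℕ, g ((f ^ n) x) = (f ^ n) x := fun n => by
    rw [← (hfg.pow_left n).perm_apply, hgx]
  have hfix1 : g (f x) = f x := by simpa using hfixf 1
  have hlo : ∀ (k : ℕ) (z : HalfOpen), f x ≤ z → f x ≤ (g ^ k) z := fun k z hz => by
    rw [← hfixpow _ k hfix1]
    exact (hgm k).monotone hz
  have hhi : ∀ (k : ℕ) (z : HalfOpen), z ≤ x → (g ^ k) z ≤ x := fun k z hz => by
    conv_rhs => rw [← hfixpow _ k hgx]
    exact (hgm k).monotone hz
  have hgyx : g y ≤ x := by simpa using hhi 1 y hyx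
  have hfgy : f x ≤ g y := hy.trans hgy.le
  have hpos : (0 : ℝ) < g y - y := sub_pos.2 hgy
  -- Both `δ` and `n` depend on `k`, but the distortion constant `C` does not.
  have hlow : ∀ k : ℕ, ((g y : ℝ) - y) / (2 * C) ≤ (g ^ k) (g y) - (g ^ k) y := fun k => by
    obtain ⟨δ, hδ, hhalf⟩ := exists_half_le_slope (pow_mem hg k).2.1 (hgm k).perm_zero
      (fun δ hδ => by
        obtain ⟨n, hn⟩ := exists_iterate_lt hf.1 hlt x hδ
        exact ⟨(f ^ n) x, (hfm n).perm_pos hx, hn, hfixpow _ k (hfixf n)⟩)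
    obtain ⟨n, hn⟩ := exists_iterate_lt hf.1 hlt x hδ
    have h1 := hhalf ((f ^ n) y) ((f ^ n) (g y)) (hfm n hgy)
      (lt_of_le_of_lt (show ((f ^ n) (g y) : ℝ) ≤ (f ^ n) x from (hfm n).monotone hgyx) hn)
    have h2 := hdist n ((g ^ k) y) ((g ^ k) (g y)) y (g y) (hlo k y hy) (hgm k hgy) (hhi k _ hgyx)
      hy hgy hgyx
    rw [((hfg.pow_left n).pow_right k).perm_apply, ((hfg.pow_left n).pow_right k).perm_apply] at h2
    have hA : (0 : ℝ) < (f ^ n) (g y) - (f ^ n) y := sub_pos.2 (hfm n hgy)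
    rw [div_le_iff₀ (by positivity)]
    refine le_of_mul_le_mul_left ?_ hA
    nlinarith
  have hsum : ∀ k : ℕ, k * (((g y : ℝ) - y) / (2 * C)) ≤ (g ^ k) y - y := fun k => by
    induction k with
    | zero => simp
    | succ k ih =>
      have := hlow k
      rw [← Equiv.Perm.mul_apply, ← pow_succ] at this
      rw [Nat.cast_succ, add_mul, one_mul]
      linarith
  obtain ⟨k, hk⟩ := exists_nat_gt (1 / (((g y : ℝ) - y) / (2 * C)))
  have h1 := hsum k
  rw [div_lt_iff₀ (by positivity)] at hk
  linarith [((g ^ k) y).2.2, y.2.1]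

/-- **Kopell's lemma**: a `C¹` diffeomorphism of `[0, 1)` commuting with a `C²` diffeomorphism
without interior fixed points is the identity as soon as it has an interior fixed point. -/
theorem kopell {f g : Equiv.Perm HalfOpen} (hf : f ∈ DiffPlus 2) (hg : g ∈ DiffPlus 1)
    (hfg : Commute f g) (hne : ∀ x : HalfOpen, 0 < (x : ℝ) → f x ≠ x)
    {c : HalfOpen} (hc : 0 < (c : ℝ)) (hgc : g c = c) : g = 1 := by
  wlog hlt : ∀ x : HalfOpen, 0 < (x : ℝ) → f x < x generalizing f
  · have hgt := (lt_self_or_self_lt_of_forall_ne hf.1 hne).resolve_left hlt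
    have hinv : ∀ x : HalfOpen, 0 < (x : ℝ) → f⁻¹ x < x := fun x hx => by
      simpa using hgt (f⁻¹ x) ((inv_mem hf).1.perm_pos hx)
    exact this (inv_mem hf) hfg.inv_left (fun x hx => (hinv x hx).ne) hinv
  have hfm : ∀ n : ℕ, StrictMono (f ^ n) := fun n => (pow_mem hf n).1
  have hdom : ∀ x y : HalfOpen, 0 < (x : ℝ) → g x = x → f x ≤ y → y ≤ x → g y = y := by
    intro x y hx hgx hy hyx
    refine le_antisymm (kopell_fundamental_domain hf hg hfg hlt hx hgx hy hyx) ?_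
    have := kopell_fundamental_domain hf (inv_mem hg) hfg.inv_right hlt hx
      (by rw [Equiv.Perm.inv_eq_iff_eq, hgx]) hy hyx
    simpa using hg.1.monotone this
  have hfixf : ∀ n : ℕ, g ((f ^ n) c) = (f ^ n) c := fun n => by
    rw [← (hfg.pow_left n).perm_apply, hgc]
  have hsmall : ∀ y : HalfOpen, 0 < (y : ℝ) → y ≤ c → g y = y := by
    intro y hy hyc
    have hex : ∃ n : ℕ, (f ^ n) c < y := exists_iterate_lt hf.1 hlt c hy
    classical
    -- The first iterate of `c` below `y` places `y` in a fundamental domain whose endpoints are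
    -- fixed by `g`.
    have hspec := Nat.find_spec hex
    have hmin := fun m => Nat.find_min hex (m := m)
    rcases hn : Nat.find hex with _ | n
    · rw [hn] at hspec
      exact absurd hspec (not_lt.2 hyc)
    · rw [hn] at hspec hmin
      refine hdom ((f ^ n) c) y ((hfm n).perm_pos hc) (hfixf n) ?_
        (not_lt.1 (hmin n (Nat.lt_succ_self n)))
      rw [pow_succ', Equiv.Perm.mul_apply] at hspec
      exact hspec.le
  ext1 y
  rw [Equiv.Perm.one_apply]
  rcases y.2.1.eq_or_lt with h0 | h0
  · have : y = HalfOpen.zero := Subtype.ext h0.symm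
    rw [this, hg.1.perm_zero]
  · obtain ⟨n, hn⟩ := exists_iterate_lt hf.1 hlt y hc
    have := hsmall ((f ^ n) y) ((hfm n).perm_pos h0) (le_of_lt hn)
    rw [← (hfg.pow_left n).perm_apply] at this
    exact (f ^ n).injective this

/-! ### Bump diffeomorphisms -/

/-- `g` is increasing, is the identity off `(a, b)`, and moves every point of `(a, b)` up. -/
structure IsBumpOn (g : Equiv.Perm HalfOpen) (a b : HalfOpen) : Prop where
  strictMono : StrictMono g
  eq_of_le : ∀ x, x ≤ a → g x = x
  eq_of_ge : ∀ x, b ≤ x → g x = x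
  lt_apply : ∀ x, a < x → x < b → x < g x

theorem IsBumpOn.conj {g k : Equiv.Perm HalfOpen} {a b : HalfOpen} (h : IsBumpOn g a b)
    (hk : StrictMono k) (hk' : StrictMono (k⁻¹ : Equiv.Perm HalfOpen)) : IsBumpOn (k * g * k⁻¹) (k a) (k b) where
  strictMono := (hk.comp h.strictMono).comp hk'
  eq_of_le x hx := by
    have : k⁻¹ x ≤ a := by simpa using hk'.monotone hx
    rw [Equiv.Perm.mul_apply, Equiv.Perm.mul_apply, h.eq_of_le _ this]
    exact k.apply_symm_apply x
  eq_of_ge x hx := by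
    have : b ≤ k⁻¹ x := by simpa using hk'.monotone hx
    rw [Equiv.Perm.mul_apply, Equiv.Perm.mul_apply, h.eq_of_ge _ this]
    exact k.apply_symm_apply x
  lt_apply x hx hx' := by
    have h1 : a < k⁻¹ x := by simpa using hk' hx
    have h2 : k⁻¹ x < b := by simpa using hk' hx'
    simpa using hk (h.lt_apply _ h1 h2)

theorem IsBumpOn.commute {g h : Equiv.Perm HalfOpen} {a b a' b' : HalfOpen} (hg : IsBumpOn g a b)
    (hh : IsBumpOn h a' b') (hle : b ≤ a') : Commute g h := by
  ext1 x
  rw [Equiv.Perm.mul_apply, Equiv.Perm.mul_apply]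
  rcases le_total x b with hx | hx
  · have h1 : g x ≤ b := (hg.strictMono.monotone hx).trans_eq (hg.eq_of_ge b le_rfl)
    rw [hh.eq_of_le _ (hx.trans hle), hh.eq_of_le _ (h1.trans hle)]
  · have h1 : b ≤ h x := (hh.eq_of_le b hle).symm.le.trans (hh.strictMono.monotone hx)
    rw [hg.eq_of_ge _ hx, hg.eq_of_ge _ h1]

/-- Commutation would make `g a'` a fixed point of `h`, since `h` fixes `a'`; but `g a'` lies inside
`(a', b')`. -/
theorem IsBumpOn.not_commute {g h : Equiv.Perm HalfOpen} {a b a' b' : HalfOpen}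
    (hg : IsBumpOn g a b) (hh : IsBumpOn h a' b') (h1 : a < a') (h2 : a' < b) (h3 : b < b') :
    ¬ Commute g h := by
  intro hc
  have h4 := hg.lt_apply a' h1 h2
  have h5 : g a' < b := (hg.strictMono h2).trans_eq (hg.eq_of_ge b le_rfl)
  have h6 := hc.perm_apply a'
  rw [hh.eq_of_le a' le_rfl] at h6
  exact (hh.lt_apply _ h4 (h5.trans h3)).ne h6

/-- A smooth function that is positive on `(a, b)`, zero elsewhere, and of slope at most `1 / 2`. -/
theorem exists_contDiff_pos_on_Ioo (r : ℕ∞) (a b : ℝ) :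
    ∃ β : ℝ → ℝ, ContDiff ℝ r β ∧ (∀ x, x ≤ a → β x = 0) ∧ (∀ x, b ≤ x → β x = 0) ∧
      (∀ x, a < x → x < b → 0 < β x) ∧ ∀ x, |deriv β x| ≤ 1 / 2 := by
  let β₀ : ℝ → ℝ := fun x => expNegInvGlue (x - a) * expNegInvGlue (b - x)
  have hβ₀ : ∀ n : ℕ∞, ContDiff ℝ n β₀ := fun n =>
    (expNegInvGlue.contDiff.comp (contDiff_id.sub contDiff_const)).mul
      (expNegInvGlue.contDiff.comp (contDiff_const.sub contDiff_id))
  have ha : ∀ x, x ≤ a → β₀ x = 0 := fun x hx => by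
    simp [β₀, expNegInvGlue.zero_of_nonpos (sub_nonpos.2 hx)]
  have hb : ∀ x, b ≤ x → β₀ x = 0 := fun x hx => by
    simp [β₀, expNegInvGlue.zero_of_nonpos (sub_nonpos.2 hx)]
  have hpos : ∀ x, a < x → x < b → 0 < β₀ x := fun x h1 h2 =>
    mul_pos (expNegInvGlue.pos_of_pos (sub_pos.2 h1)) (expNegInvGlue.pos_of_pos (sub_pos.2 h2))
  have hsupp : HasCompactSupport β₀ := HasCompactSupport.intro (isCompact_Icc (a := a) (b := b))
    fun x hx => by
      rcases not_and_or.1 hx with h | h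
      · exact ha x (not_le.1 h).le
      · exact hb x (not_le.1 h).le
  have hdc : Continuous (deriv β₀) := (hβ₀ 1).continuous_deriv (by simp)
  obtain ⟨M, hM⟩ := hdc.bounded_above_of_compact_support hsupp.deriv
  have hM0 : 0 ≤ M := (norm_nonneg _).trans (hM 0)
  refine ⟨fun x => (1 / (2 * M + 2)) * β₀ x, contDiff_const.mul (hβ₀ r), fun x hx => ?_,
    fun x hx => ?_, fun x h1 h2 => mul_pos (by positivity) (hpos x h1 h2), fun x => ?_⟩
  · simp [ha x hx]
  · simp [hb x hx]
  · rw [deriv_const_mul _ ((hβ₀ 1).differentiable (by simp) x), abs_mul,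
      abs_of_pos (by positivity), one_div_mul_eq_div, div_le_div_iff₀ (by positivity) two_pos]
    have := hM x
    rw [Real.norm_eq_abs] at this
    linarith

theorem exists_isBumpOn (r : ℕ∞) (a b : HalfOpen) :
    ∃ g ∈ DiffPlus r, IsBumpOn g a b := by
  -- The diffeomorphism is `y + β y`, whose derivative is at least `1 / 2`. Order `r + 1` keeps `β`
  -- differentiable when `r = 0`.
  obtain ⟨β, hβ, ha, hb, hpos, hder⟩ := exists_contDiff_pos_on_Ioo (r + 1) a b
  have hd : ∀ x, HasDerivAt (fun y => y + β y) (1 + deriv β x) x := fun x =>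
    (hasDerivAt_id x).add ((hβ.differentiable (by
      have : ((r + 1 : ℕ∞)) ≠ 0 := by simp
      exact_mod_cast this)) x).hasDerivAt
  have hdpos : ∀ x, 0 < 1 + deriv β x := fun x => by linarith [(abs_le.1 (hder x)).1]
  have hmono : StrictMono fun y => y + β y :=
    strictMono_of_deriv_pos fun x => by rw [(hd x).deriv]; exact hdpos x
  have hcont : Continuous fun y => y + β y := continuous_iff_continuousAt.2 fun x => (hd x).continuousAt
  have hβ0 : ∀ x, 0 ≤ β x := fun x => by
    rcases le_or_gt x a with h | h
    · exact (ha x h).ge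
    rcases le_or_gt (b : ℝ) x with h' | h'
    · exact (hb x h').ge
    exact (hpos x h h').le
  have hsurj : Function.Surjective fun y => y + β y := fun y => by
    have h1 : (min a y : ℝ) + β (min a y) ≤ y := by
      rw [ha _ (min_le_left _ _), add_zero]
      exact min_le_right _ _
    have h2 : y ≤ y + β y := le_add_of_nonneg_right (hβ0 y)
    obtain ⟨x, -, hx⟩ := intermediate_value_Icc (min_le_right (a : ℝ) y) hcont.continuousOn ⟨h1, h2⟩
    exact ⟨x, hx⟩
  let e : ℝ ≃ₜ ℝ := (hmono.orderIsoOfSurjective _ hsurj).toHomeomorph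
  have he : ∀ x, e x = x + β x := fun x => rfl
  have hsmooth : ContDiff ℝ r fun y => y + β y :=
    contDiff_id.add (hβ.of_le (by exact_mod_cast le_self_add))
  have hsymm : ContDiff ℝ r e.symm := e.contDiff_symm_deriv (fun x => (hdpos x).ne') hd hsmooth
  have hea : ∀ x, x ≤ (a : ℝ) → e x = x := fun x hx => by rw [he, ha x hx, add_zero]
  have heb : ∀ x, (b : ℝ) ≤ x → e x = x := fun x hx => by rw [he, hb x hx, add_zero]
  have he0 : e 0 = 0 := hea 0 a.2.1
  have he1 : e 1 = 1 := heb 1 b.2.2.le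
  have hIco : ∀ x, e x ∈ Ico (0 : ℝ) 1 ↔ x ∈ Ico (0 : ℝ) 1 := fun x => by
    have h0 : e 0 ≤ e x ↔ 0 ≤ x := hmono.le_iff_le
    have h1 : e x < e 1 ↔ x < 1 := hmono.lt_iff_lt
    rw [mem_Ico, mem_Ico, ← h0, ← h1, he0, he1]
  let g : Equiv.Perm HalfOpen :=
    { toFun := fun x => ⟨e x, (hIco x).2 x.2⟩
      invFun := fun x => ⟨e.symm x, (hIco _).1 (by rw [e.apply_symm_apply]; exact x.2)⟩
      left_inv := fun x => Subtype.ext (e.symm_apply_apply x)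
      right_inv := fun x => Subtype.ext (e.apply_symm_apply x) }
  have hg : StrictMono g := fun x y hxy => hmono (show (x : ℝ) < y from hxy)
  refine ⟨g, ⟨hg, ⟨e, hsmooth.contDiffOn, fun _ => rfl⟩, ⟨e.symm, hsymm.contDiffOn, fun _ => rfl⟩⟩,
    hg, fun x hx => Subtype.ext (hea x hx), fun x hx => Subtype.ext (heb x hx), fun x h1 h2 => ?_⟩
  exact show (x : ℝ) < x + β x from lt_add_of_pos_right _ (hpos x h1 h2)

/-! ### Flows without global fixed points -/

theorem map_zero_of_map_add {r : ℕ∞} {φ : ℝ → DiffPlus r}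
    (h : ∀ s t : ℝ, φ (s + t) = φ s * φ t) : φ 0 = 1 := by
  have := h 0 0
  rwa [add_zero, left_eq_mul] at this

theorem map_neg_of_map_add {r : ℕ∞} {φ : ℝ → DiffPlus r}
    (h : ∀ s t : ℝ, φ (s + t) = φ s * φ t) (t : ℝ) : φ (-t) = (φ t)⁻¹ := by
  rw [eq_inv_iff_mul_eq_one, ← h, neg_add_cancel, map_zero_of_map_add h]

theorem map_add_apply {r : ℕ∞} {φ : ℝ → DiffPlus r} (h : ∀ s t : ℝ, φ (s + t) = φ s * φ t)
    (s t : ℝ) (x : HalfOpen) :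
    (φ (s + t) : Equiv.Perm HalfOpen) x =
      (φ s : Equiv.Perm HalfOpen) ((φ t : Equiv.Perm HalfOpen) x) := by
  rw [h]
  rfl

/-- The supremum of a bounded orbit would be fixed by the whole flow. -/
theorem IsFlow.exists_lt_apply {r : ℕ∞} {φ : ℝ → DiffPlus r} (hφ : IsFlow φ)
    (hfree : ∀ x : HalfOpen, 0 < (x : ℝ) → ∃ t : ℝ, (φ t : Equiv.Perm HalfOpen) x ≠ x)
    {c : HalfOpen} (hc : 0 < (c : ℝ)) (y : HalfOpen) :
    ∃ t : ℝ, y < (φ t : Equiv.Perm HalfOpen) c := by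
  by_contra! h
  let S : Set ℝ := range fun t : ℝ => ((φ t : Equiv.Perm HalfOpen) c : ℝ)
  have hS : IsLUB S (sSup S) := isLUB_csSup (range_nonempty _)
    ⟨y, by rintro _ ⟨t, rfl⟩; exact h t⟩
  have h0 : (c : ℝ) ≤ sSup S := hS.1 ⟨0, by simp [map_zero_of_map_add hφ.map_add]⟩
  have h1 : sSup S ≤ y := hS.2 (by rintro _ ⟨t, rfl⟩; exact h t)
  let M : HalfOpen := ⟨sSup S, hc.le.trans h0, h1.trans_lt y.2.2⟩
  have hM : IsLUB (range fun t : ℝ => (φ t : Equiv.Perm HalfOpen) c) M := by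
    constructor
    · rintro _ ⟨t, rfl⟩
      exact hS.1 ⟨t, rfl⟩
    · intro z hz
      refine hS.2 ?_
      rintro _ ⟨t, rfl⟩
      exact hz ⟨t, rfl⟩
  obtain ⟨u, hu⟩ := hfree M (hc.trans_le h0)
  apply hu
  have hmono := (φ u).2.1
  let e := hmono.orderIsoOfSurjective _ (φ u : Equiv.Perm HalfOpen).surjective
  have h2 : IsLUB (e '' range fun t : ℝ => (φ t : Equiv.Perm HalfOpen) c) (e M) :=
    e.isLUB_image'.2 hM
  have h3 : (e '' range fun t : ℝ => (φ t : Equiv.Perm HalfOpen) c) =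
      range fun t : ℝ => (φ t : Equiv.Perm HalfOpen) c := by
    ext z
    constructor
    · rintro ⟨_, ⟨t, rfl⟩, rfl⟩
      exact ⟨u + t, map_add_apply hφ.map_add u t c⟩
    · rintro ⟨t, rfl⟩
      refine ⟨_, ⟨-u + t, rfl⟩, ?_⟩
      change (φ u : Equiv.Perm HalfOpen) ((φ (-u + t) : Equiv.Perm HalfOpen) c) = _
      rw [← map_add_apply hφ.map_add, add_neg_cancel_left]
  rw [h3] at h2
  exact h2.unique hM

/-- A repeated value makes the orbit periodic, hence compact, so it would have a greatest element.
-/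
theorem IsFlow.apply_injective {r : ℕ∞} {φ : ℝ → DiffPlus r} (hφ : IsFlow φ)
    (hfree : ∀ x : HalfOpen, 0 < (x : ℝ) → ∃ t : ℝ, (φ t : Equiv.Perm HalfOpen) x ≠ x)
    {c : HalfOpen} (hc : 0 < (c : ℝ)) :
    Function.Injective fun t : ℝ => (φ t : Equiv.Perm HalfOpen) c := by
  intro t u htu
  by_contra hne
  have hcont : Continuous fun t : ℝ => (φ t : Equiv.Perm HalfOpen) c :=
    hφ.continuous_family.comp (continuous_id.prodMk continuous_const)
  have hper : Function.Periodic (fun t : ℝ => (φ t : Equiv.Perm HalfOpen) c) (t - u) := fun s => by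
    have h1 : s + (t - u) = (s - u) + t := by ring
    have h2 : s = (s - u) + u := by ring
    change (φ (s + (t - u)) : Equiv.Perm HalfOpen) c = (φ s : Equiv.Perm HalfOpen) c
    rw [h1, map_add_apply hφ.map_add]
    conv_rhs => rw [h2, map_add_apply hφ.map_add]
    exact congrArg _ htu
  obtain ⟨y, hy⟩ := (hper.compact_of_continuous (sub_ne_zero.2 hne) hcont).exists_isGreatest
    (range_nonempty _)
  obtain ⟨s, hs⟩ := hφ.exists_lt_apply hfree hc y
  exact absurd (hy.2 ⟨s, rfl⟩) (not_le.2 hs)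

/-- The conjugate by `φ t` of a bump on `(φ 0 c, φ 1 c)` is a bump on `(φ t c, φ (t + 1) c)`: the
supports have disjoint interiors for `|t| > 1` and overlap partially for `t = 1 / 2`. -/
theorem exists_commute_conj_of_strictMono {r : ℕ∞} {φ : ℝ → DiffPlus r}
    (hadd : ∀ s t : ℝ, φ (s + t) = φ s * φ t) {c : HalfOpen}
    (hmono : StrictMono fun t : ℝ => (φ t : Equiv.Perm HalfOpen) c) :
    ∃ (g : DiffPlus r) (T t₀ : ℝ), (∀ t : ℝ, T < |t| → Commute g (φ t * g * (φ t)⁻¹)) ∧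
      ¬ Commute g (φ t₀ * g * (φ t₀)⁻¹) := by
  obtain ⟨g, hg, hbump⟩ := exists_isBumpOn r ((φ 0 : Equiv.Perm HalfOpen) c)
    ((φ 1 : Equiv.Perm HalfOpen) c)
  have hconj : ∀ t : ℝ, IsBumpOn (φ t * g * (φ t : Equiv.Perm HalfOpen)⁻¹)
      ((φ t : Equiv.Perm HalfOpen) c) ((φ (t + 1) : Equiv.Perm HalfOpen) c) := fun t => by
    have := hbump.conj (φ t).2.1 ((φ t)⁻¹).2.1
    rwa [← map_add_apply hadd, ← map_add_apply hadd, add_zero] at this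
  refine ⟨⟨g, hg⟩, 1, 1 / 2, fun t ht => ?_, fun h => ?_⟩
  · refine Subtype.ext ?_
    rcases lt_abs.1 ht with h | h
    · exact hbump.commute (hconj t) (hmono.monotone h.le) |>.eq
    · exact ((hconj t).commute hbump (hmono.monotone (by linarith))).symm.eq
  · refine hbump.not_commute (hconj (1 / 2)) (hmono (by norm_num)) (hmono (by norm_num))
      (hmono (by norm_num)) ?_
    exact congrArg Subtype.val h.eq

theorem IsFlow.exists_commute_conj {r : ℕ∞} {φ : ℝ → DiffPlus r} (hφ : IsFlow φ)
    (hfree : ∀ x : HalfOpen, 0 < (x : ℝ) → ∃ t : ℝ, (φ t : Equiv.Perm HalfOpen) x ≠ x) :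
    ∃ (g : DiffPlus r) (T t₀ : ℝ), (∀ t : ℝ, T < |t| → Commute g (φ t * g * (φ t)⁻¹)) ∧
      ¬ Commute g (φ t₀ * g * (φ t₀)⁻¹) := by
  let c : HalfOpen := ⟨1 / 2, by norm_num, by norm_num⟩
  have hc : 0 < (c : ℝ) := by norm_num [c]
  have hcont : Continuous fun t : ℝ => (φ t : Equiv.Perm HalfOpen) c :=
    hφ.continuous_family.comp (continuous_id.prodMk continuous_const)
  rcases hcont.strictMono_of_inj (hφ.apply_injective hfree hc) with h | h
  · exact exists_commute_conj_of_strictMono hφ.map_add h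
  -- A decreasing orbit becomes increasing when time is reversed.
  · obtain ⟨g, T, t₀, h1, h2⟩ := exists_commute_conj_of_strictMono (φ := fun t => φ (-t)) (c := c)
      (fun s t => by rw [neg_add, hφ.map_add]) (fun s t hst => h (neg_lt_neg hst))
    exact ⟨g, T, -t₀, fun t ht => by simpa using h1 (-t) (by rwa [abs_neg]), h2⟩

/-! ### Free actions of abelian groups and their translation numbers -/

/-- An action of an additive group on `[0, 1)` by increasing bijections. -/
structure IsIncreasingAction {A : Type*} [AddCommGroup A] (f : A → Equiv.Perm HalfOpen) :
    Prop where
  map_add : ∀ s t, f (s + t) = f s * f t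
  strictMono : ∀ t, StrictMono (f t)

namespace IsIncreasingAction

variable {A : Type*} [AddCommGroup A] {f : A → Equiv.Perm HalfOpen}

theorem add_apply (hf : IsIncreasingAction f) (s t : A) (x : HalfOpen) :
    f (s + t) x = f s (f t x) := by
  rw [hf.map_add, Equiv.Perm.mul_apply]

theorem map_zero (hf : IsIncreasingAction f) : f 0 = 1 := by
  have := hf.map_add 0 0
  rwa [add_zero, left_eq_mul] at this

theorem map_neg (hf : IsIncreasingAction f) (t : A) : f (-t) = (f t)⁻¹ := by
  rw [eq_inv_iff_mul_eq_one, ← hf.map_add, neg_add_cancel, hf.map_zero]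

theorem map_nsmul (hf : IsIncreasingAction f) (n : ℕ) (t : A) : f (n • t) = f t ^ n := by
  induction n with
  | zero => rw [zero_nsmul, hf.map_zero, pow_zero]
  | succ n ih => rw [succ_nsmul, hf.map_add, ih, pow_succ]

theorem apply_lt_apply_iff (hf : IsIncreasingAction f) (s t : A) (x : HalfOpen) :
    f s x < f t x ↔ x < f (t - s) x := by
  conv_lhs => rw [show t = s + (t - s) by abel, hf.add_apply, (hf.strictMono s).lt_iff_lt]

theorem lt_apply_iff (hf : IsIncreasingAction f)
    (hfree : ∀ (t : A) (x : HalfOpen), 0 < (x : ℝ) → f t x = x → t = 0) (t : A) {x y : HalfOpen}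
    (hx : 0 < (x : ℝ)) (hy : 0 < (y : ℝ)) : x < f t x ↔ y < f t y := by
  by_cases ht : t = 0
  · simp [ht, hf.map_zero]
  · rcases lt_self_or_self_lt_of_forall_ne (hf.strictMono t)
      (fun z hz h => ht (hfree t z hz h)) with h | h
    · exact iff_of_false (h x hx).not_gt (h y hy).not_gt
    · exact iff_of_true (h x hx) (h y hy)

/-- **Hölder's theorem** for free actions on `(0, 1)`. -/
theorem exists_translation_number (hf : IsIncreasingAction f)
    (hfree : ∀ (t : A) (x : HalfOpen), 0 < (x : ℝ) → f t x = x → t = 0) :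
    ∃ α : A →+ ℝ, ∀ (s t : A) (x : HalfOpen), 0 < (x : ℝ) → (f s x < f t x ↔ α s < α t) := by
  let c : HalfOpen := ⟨1 / 2, by norm_num, by norm_num⟩
  have hc : 0 < (c : ℝ) := by norm_num [c]
  have hinj : Function.Injective fun t => f t c := fun s t hst => by
    have h : f (-s + t) c = c := by
      change f s c = f t c at hst
      rw [hf.add_apply, ← hst, hf.map_neg, Equiv.Perm.inv_def, Equiv.symm_apply_apply]
    have := hfree _ c hc h
    rwa [neg_add_eq_zero] at this
  -- `A` is ordered by the orbit of `c`. By freeness the order does not depend on `c`.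
  let _ : LinearOrder A := LinearOrder.lift' (fun t => f t c) hinj
  have hlt : ∀ s t : A, s < t ↔ f s c < f t c := fun s t => Iff.rfl
  have hle : ∀ s t : A, s ≤ t ↔ f s c ≤ f t c := fun s t => Iff.rfl
  have : IsOrderedAddMonoid A := by
    have key : ∀ a b : A, a ≤ b → ∀ d : A, d + a ≤ d + b := fun a b hab d => by
      rw [hle, hf.add_apply, hf.add_apply]
      exact (hf.strictMono d).monotone hab
    constructor
    · intro a b hab d
      simpa only [add_comm] using key a b hab d
    · intro a b hab d
      simpa only [add_comm] using key a b hab d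
  -- For `b > 0` the iterates of `f (-b)` push `f a c` below `c`, which means `a ≤ n • b`.
  have : Archimedean A := by
    constructor
    intro a b hb
    rw [hlt, hf.map_zero, Equiv.Perm.one_apply] at hb
    have hneg : ∀ x : HalfOpen, 0 < (x : ℝ) → f (-b) x < x := fun x hx => by
      rw [← (hf.strictMono b).lt_iff_lt, hf.map_neg, Equiv.Perm.inv_def, Equiv.apply_symm_apply]
      exact (hf.lt_apply_iff hfree b hc hx).1 hb
    obtain ⟨n, hn⟩ := exists_iterate_lt (hf.strictMono (-b)) hneg (f a c) hc
    refine ⟨n, ?_⟩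
    rw [hle, ← (hf.strictMono (n • -b)).le_iff_le]
    have h1 : f (n • -b) (f (n • b) c) = c := by
      rw [← hf.add_apply, ← smul_add, neg_add_cancel, smul_zero, hf.map_zero,
        Equiv.Perm.one_apply]
    rw [h1, hf.map_nsmul]
    exact le_of_lt hn
  obtain ⟨α, hα⟩ := Archimedean.exists_orderAddMonoidHom_real_injective A
  refine ⟨α, fun s t x hx => ?_⟩
  have hmono : StrictMono α := α.monotone'.strictMono_of_injective hα
  change _ ↔ α s < α t
  rw [hmono.lt_iff_lt, hlt, hf.apply_lt_apply_iff, hf.apply_lt_apply_iff s t c]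
  exact hf.lt_apply_iff hfree _ hx hc

/-- An uncountable group has no wandering intervals. -/
theorem exists_apply_lt [Uncountable A] (hf : IsIncreasingAction f) {α : A →+ ℝ}
    (hinj : Function.Injective α) {x b : HalfOpen} (hxb : x < b) :
    ∃ t, 0 < α t ∧ f t x < b := by
  by_contra! h
  -- Otherwise the translates of `(x, b)` would be uncountably many disjoint nonempty open
  -- intervals.
  have hlt : ∀ s t : A, α s < α t → Disjoint (Ioo (f s x) (f s b)) (Ioo (f t x) (f t b)) := by
    intro s t hst
    have h1 := (hf.strictMono s).monotone (h (t - s) (by rw [map_sub]; linarith))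
    rw [← hf.add_apply, add_sub_cancel] at h1
    exact Set.disjoint_left.2 fun z hz hz' => (hz.2.trans_le h1).not_gt hz'.1
  have hdisj : Pairwise fun s t : A => Disjoint (Ioo (f s x) (f s b)) (Ioo (f t x) (f t b)) := by
    intro s t hst
    rcases (hinj.ne hst).lt_or_gt with h | h
    · exact hlt s t h
    · exact (hlt t s h).symm
  have hcount : (univ : Set A).Countable :=
    Set.PairwiseDisjoint.countable_of_isOpen (hdisj.set_pairwise univ) (fun _ _ => isOpen_Ioo) fun t _ => by
      obtain ⟨m, hm⟩ := exists_between (show (x : ℝ) < b from hxb)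
      exact ⟨f t ⟨m, x.2.1.trans hm.1.le, hm.2.trans b.2.2⟩,
        hf.strictMono t hm.1, hf.strictMono t hm.2⟩
  exact not_countable (α := A) (countable_univ_iff.1 hcount)

/-- A free action of an uncountable group is continuous for the topology induced by translation
numbers. -/
theorem tendsto_apply [Uncountable A] (hf : IsIncreasingAction f) {α : A →+ ℝ}
    (hα : ∀ (s t : A) (x : HalfOpen), 0 < (x : ℝ) → (f s x < f t x ↔ α s < α t))
    (hinj : Function.Injective α) (t₀ : A) (x : HalfOpen) :
    Tendsto (fun q : A × HalfOpen => f q.1 q.2) (comap α (𝓝 (α t₀)) ×ˢ 𝓝 x) (𝓝 (f t₀ x)) := by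
  have hinv : ∀ y : HalfOpen, f t₀ (f (-t₀) y) = y := fun y => by
    rw [← hf.add_apply, add_neg_cancel, hf.map_zero, Equiv.Perm.one_apply]
  have hev : ∀ t, 0 < α t → ∀ᶠ u in comap α (𝓝 (α t₀)), |α (-t₀ + u)| < α t := fun t ht => by
    have : ∀ᶠ y in 𝓝 (α t₀), |y - α t₀| < α t := by
      filter_upwards [Metric.ball_mem_nhds (α t₀) ht] with y hy
      rwa [Metric.mem_ball, Real.dist_eq] at hy
    filter_upwards [tendsto_comap.eventually this] with u hu
    rwa [_root_.map_add, _root_.map_neg, neg_add_eq_sub]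
  have hmid : ∀ y z : HalfOpen, y < z → ∃ m : HalfOpen, y < m ∧ m < z := fun y z hyz => by
    obtain ⟨m, hm⟩ := exists_between (show (y : ℝ) < z from hyz)
    exact ⟨⟨m, y.2.1.trans hm.1.le, hm.2.trans z.2.2⟩, hm.1, hm.2⟩
  refine tendsto_order.2 ⟨fun a ha => ?_, fun b hb => ?_⟩
  · have ha' : f (-t₀) a < x := by rwa [← (hf.strictMono t₀).lt_iff_lt, hinv]
    obtain ⟨m, ham, hmx⟩ := hmid _ _ ha'
    have hm0 : 0 < (m : ℝ) := (f (-t₀) a).2.1.trans_lt ham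
    -- `exists_apply_lt` only gives small upward moves. If `f t` keeps `m'` below `m`, then its
    -- inverse keeps `m` above `m'`.
    obtain ⟨m', hm', hm'm⟩ := hmid _ _ ham
    obtain ⟨t, ht, htm⟩ := hf.exists_apply_lt hinj hm'm
    filter_upwards [(hev t ht).prod_mk (lt_mem_nhds hmx)] with ⟨u, y⟩ ⟨hu, hy⟩
    have h1 : f (-t) m < f (-t₀ + u) m := (hα _ _ m hm0).2 (by
      rw [_root_.map_neg]
      exact (abs_lt.1 hu).1)
    have h2 : m' < f (-t) m := by
      rw [← (hf.strictMono t).lt_iff_lt, ← hf.add_apply, add_neg_cancel, hf.map_zero]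
      exact htm
    have h3 : f (-t₀) a < f (-t₀ + u) y :=
      hm'.trans (h2.trans (h1.trans (hf.strictMono _ hy)))
    rwa [hf.add_apply, (hf.strictMono _).lt_iff_lt] at h3
  · have hb' : x < f (-t₀) b := by rwa [← (hf.strictMono t₀).lt_iff_lt, hinv]
    obtain ⟨m, hxm, hmb⟩ := hmid _ _ hb'
    have hm0 : 0 < (m : ℝ) := x.2.1.trans_lt hxm
    obtain ⟨t, ht, htm⟩ := hf.exists_apply_lt hinj hmb
    filter_upwards [(hev t ht).prod_mk (gt_mem_nhds hxm)] with ⟨u, y⟩ ⟨hu, hy⟩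
    have h1 : f (-t₀ + u) m < f t m := (hα _ _ m hm0).2 (abs_lt.1 hu).2
    have h3 : f (-t₀ + u) y < f (-t₀) b := (hf.strictMono _ hy).trans (h1.trans htm)
    rwa [hf.add_apply, (hf.strictMono _).lt_iff_lt] at h3

/-- Commutation with conjugates passes to limits of translation numbers. -/
theorem commute_conj_of_tendsto [Uncountable A] (hf : IsIncreasingAction f) {α : A →+ ℝ}
    (hα : ∀ (s t : A) (x : HalfOpen), 0 < (x : ℝ) → (f s x < f t x ↔ α s < α t))
    (hinj : Function.Injective α) {g : Equiv.Perm HalfOpen} (hg : StrictMono g) {S : Set A}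
    (hS : ∀ t ∈ S, Commute g (f t * g * (f t)⁻¹)) {t₀ : A} (ht₀ : α t₀ ∈ closure (α '' S)) :
    Commute g (f t₀ * g * (f t₀)⁻¹) := by
  -- The closure hypothesis makes the limit along `S` meaningful.
  have hne : (comap α (𝓝 (α t₀)) ⊓ 𝓟 S).NeBot := by
    rw [inf_principal_neBot_iff]
    rintro U ⟨V, hV, hVU⟩
    obtain ⟨_, hy, t, ht, rfl⟩ := mem_closure_iff_nhds.1 ht₀ V hV
    exact ⟨t, hVU hy, ht⟩
  have hlim : ∀ x, Tendsto (fun t => (f t * g * (f t)⁻¹) x) (comap α (𝓝 (α t₀)))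
      (𝓝 ((f t₀ * g * (f t₀)⁻¹) x)) := fun x => by
    have hneg : Tendsto (fun t => -t) (comap α (𝓝 (α t₀))) (comap α (𝓝 (α (-t₀)))) := by
      rw [tendsto_comap_iff, _root_.map_neg]
      simpa [Function.comp_def] using (tendsto_comap (f := α) (x := 𝓝 (α t₀))).neg
    have h1 : Tendsto (fun t => f (-t) x) (comap α (𝓝 (α t₀))) (𝓝 (f (-t₀) x)) :=
      (hf.tendsto_apply hα hinj (-t₀) x).comp (hneg.prodMk tendsto_const_nhds)
    have h2 := (hf.tendsto_apply hα hinj t₀ (g (f (-t₀) x))).comp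
      (tendsto_id.prodMk ((hg.continuous_perm.tendsto _).comp h1))
    simp only [hf.map_neg] at h2
    exact h2
  ext1 x
  have h1 := ((hg.continuous_perm.tendsto _).comp (hlim x)).mono_left
    (inf_le_left (b := 𝓟 S))
  have h2 := (hlim (g x)).mono_left (inf_le_left (b := 𝓟 S))
  refine tendsto_nhds_unique_of_eventuallyEq h1 h2 ?_
  filter_upwards [mem_inf_of_right (mem_principal_self S)] with t ht
  exact (hS t ht).perm_apply x

end IsIncreasingAction

/-- The graph of a discontinuous additive function `ℝ → ℝ` is dense. -/
theorem mem_closure_image_of_not_continuous {α : ℝ →+ ℝ} (hα : ¬ Continuous α) (T y : ℝ) :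
    y ∈ closure (α '' {t | T < |t|}) := by
  have hlin : ∃ a, α a ≠ α 1 * a := by
    by_contra! h
    exact hα ((continuous_const.mul continuous_id).congr fun a => (h a).symm)
  obtain ⟨a, ha⟩ := hlin
  have hd : α a - α 1 * a ≠ 0 := sub_ne_zero.2 ha
  -- `(p, q)` solves `p + q * a = |T| + 1`, `p * α 1 + q * α a = y`, a system with determinant `α a
  -- - α 1 * a`. Rational approximations of `(p, q)` then suffice, as `α` is `ℚ`-linear.
  let q : ℝ := (y - α 1 * (|T| + 1)) / (α a - α 1 * a)
  let p : ℝ := |T| + 1 - q * a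
  have h1 : p + q * a = |T| + 1 := sub_add_cancel _ _
  have h2 : p * α 1 + q * α a = y := by
    have : q * (α a - α 1 * a) = y - α 1 * (|T| + 1) := div_mul_cancel₀ _ hd
    linear_combination this + α 1 * h1
  have hrat : ∀ (u v : ℚ), α (u + v * a) = u * α 1 + v * α a := fun u v => by
    have hu := map_rat_smul α u (1 : ℝ)
    have hv := map_rat_smul α v a
    rw [Rat.smul_def, Rat.smul_def] at hu hv
    rw [map_add, hv, ← hu, mul_one]
  rw [mem_closure_iff_nhds]
  intro V hV
  have hc1 : Tendsto (fun z : ℝ × ℝ => z.1 * α 1 + z.2 * α a) (𝓝 (p, q)) (𝓝 y) := by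
    rw [← h2]
    exact Continuous.tendsto (by fun_prop) (p, q)
  have hc2 : Tendsto (fun z : ℝ × ℝ => z.1 + z.2 * a) (𝓝 (p, q)) (𝓝 (|T| + 1)) := by
    rw [← h1]
    exact Continuous.tendsto (by fun_prop) (p, q)
  have hev := (hc1.eventually hV).and (hc2.eventually (lt_mem_nhds (lt_add_one |T|)))
  have hdense : DenseRange (Prod.map ((↑) : ℚ → ℝ) ((↑) : ℚ → ℝ)) :=
    Rat.denseRange_cast.prodMap Rat.denseRange_cast
  obtain ⟨z, ⟨hz1, hz2⟩, ⟨u, v⟩, rfl⟩ := mem_closure_iff_nhds.1 (hdense (p, q)) _ hev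
  exact ⟨α (u + v * a), by rw [hrat]; exact hz1, _,
    (le_abs_self T).trans_lt (lt_of_lt_of_le hz2 (le_abs_self _)), rfl⟩

/-! ### Continuity of the image of the flow -/

theorem proposition3p3 (r p : ℕ∞) (hr : 2 ≤ r) (hp : 2 ≤ p)
    (Φ : DiffPlus r →* DiffPlus p) (hΦ : Function.Injective Φ)
    (φ : ℝ → DiffPlus r) (hφ : IsFlow φ)
    (hfree : ∀ x : HalfOpen, 0 < (x : ℝ) → ∃ t : ℝ, (φ t : Equiv.Perm HalfOpen) x ≠ x)
    (hs : ∃ s : ℝ, ∀ x : HalfOpen, 0 < (x : ℝ) → (Φ (φ s) : Equiv.Perm HalfOpen) x ≠ x) :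
    IsContinuousFamily (fun t : ℝ => Φ (φ t)) ∧
      ∃ ψ : ℝ → DiffPlus p, IsFlow ψ ∧ ∃ l : ℝ, ∀ t : ℝ, Φ (φ t) = ψ (l * t) := by
  have hadd : ∀ s t : ℝ, Φ (φ (s + t)) = Φ (φ s) * Φ (φ t) := fun s t => by
    rw [hφ.map_add, map_mul]
  -- Once continuous, `Φ (φ t)` is itself the flow sought, with `l = 1`.
  suffices h : IsContinuousFamily (fun t : ℝ => Φ (φ t)) from
    ⟨h, _, ⟨hadd, h⟩, 1, fun t => by rw [one_mul]⟩
  have hact : IsIncreasingAction fun t : ℝ => (Φ (φ t) : Equiv.Perm HalfOpen) :=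
    ⟨fun s t => congrArg Subtype.val (hadd s t), fun t => (Φ (φ t)).2.1⟩
  have hfaithful : ∀ t : ℝ, Φ (φ t) = 1 → t = 0 := fun t ht => by
    have h1 : φ t = 1 := hΦ (by rw [ht, map_one])
    have h2 := hφ.apply_injective hfree (c := ⟨1 / 2, by norm_num, by norm_num⟩) (by norm_num)
    exact h2 (by simp only [h1, map_zero_of_map_add hφ.map_add])
  obtain ⟨s, hs⟩ := hs
  have hfree' : ∀ (t : ℝ) (x : HalfOpen), 0 < (x : ℝ) →
      (Φ (φ t) : Equiv.Perm HalfOpen) x = x → t = 0 := fun t x hx htx => by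
    refine hfaithful t (Subtype.ext ?_)
    refine kopell (DiffPlus.mono hp (Φ (φ s)).2)
      (DiffPlus.mono ((by norm_num : (1 : ℕ∞) ≤ 2).trans hp) (Φ (φ t)).2) ?_ hs hx htx
    exact congrArg Subtype.val (by rw [← hadd, add_comm, hadd] : Φ (φ s) * Φ (φ t) = Φ (φ t) * Φ (φ s))
  obtain ⟨α, hα⟩ := hact.exists_translation_number hfree'
  -- An element with translation number `0` moves `c` neither up nor down, so freeness makes it
  -- trivial.
  have hinj : Function.Injective α := by
    rw [injective_iff_map_eq_zero]
    intro t ht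
    let c : HalfOpen := ⟨1 / 2, by norm_num, by norm_num⟩
    have hc : 0 < (c : ℝ) := by norm_num [c]
    refine hfree' t c hc ?_
    have h1 := hα 0 t c hc
    have h2 := hα t 0 c hc
    rw [ht, map_zero, hact.map_zero, Equiv.Perm.one_apply] at h1 h2
    exact le_antisymm (not_lt.1 (h1.not.2 (lt_irrefl _))) (not_lt.1 (h2.not.2 (lt_irrefl _)))
  have hcont : Continuous α := by
    by_contra hdis
    obtain ⟨g, T, t₀, hcomm, hncomm⟩ := hφ.exists_commute_conj hfree
    -- The times `|t| > T` have translation numbers accumulating at `α t₀`, so the commutation of `Φ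
    -- g` with its conjugates extends to `t₀`.
    have key := hact.commute_conj_of_tendsto hα hinj (Φ g).2.1 (S := {t | T < |t|})
      (fun t ht => congrArg Subtype.val
        (by simpa using ((hcomm t ht).map Φ).eq :
          Φ g * (Φ (φ t) * Φ g * (Φ (φ t))⁻¹) = (Φ (φ t) * Φ g * (Φ (φ t))⁻¹) * Φ g))
      (mem_closure_image_of_not_continuous hdis T (α t₀))
    refine hncomm (hΦ ?_)
    simp only [map_mul, map_inv]
    exact Subtype.ext key.eq
  refine continuous_iff_continuousAt.2 fun ⟨t, x⟩ => ?_
  have h := hact.tendsto_apply hα hinj t x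
  rw [ContinuousAt, nhds_prod_eq]
  exact h.mono_left (prod_mono (hcont.tendsto t).le_comap le_rfl)
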